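/- **Setting.** Let $\mathcal X\subseteq\mathbb R^n$ be a Borel set, $\mathcal U$ a finite non-empty input set, $\mathcal Y$ a finite output set, $f:\mathcal X\times\mathcal U\to\mathbb R^n$ with $f(\cdot,u)$ measurable for every $u$, and $h:\mathcal X\to\mathcal Y$ measurable. Let $S_\Sigma$ be the deterministic transition system with state set $\mathcal X\cup\{x_{\rm abs}\}$, all states initial, transitions $x\xrightarrow{u}f(x,u)$ if $f(x,u)\in\mathcal X$ and $x\xrightarrow{u}x_{\rm abs}$ otherwise, $x_{\rm abs}\xrightarrow{u}x_{\rm abs}$, and output map $\mathcal H(x)=h(x)$ on $\mathcal X$, $\mathcal H(x_{\rm abs})=y_{\rm abs}\notin\mathcal Y$. For a transition system $S$, an *$H$-long internal behavior* is a sequence $\xi=x_0u_0x_1\dots u_{H-1}x_H$ of successive transitions of $S$ with $x_0$ initial; its *external behavior* is $\mathcal H(\xi)=y_0u_0y_1\dots u_{H-1}y_H$, $y_i=\mathcal H(x_i)$. For an external behavior $\gamma$ and $0\le k\le H$, $\gamma[k-\ell,k]=y_{k-\ell}u_{k-\ell}\dots u_{k-1}y_k$, where inputs and outputs at negative times are the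 symbol $\diamond$; it is an *$\ell$-sequence*. For a state $x$ of $S_\Sigma$, $\mathcal E_\ell(x)$ is the set of all $\mathcal H(\xi)[j-\ell,j]$ with $\xi$ an $H$-long internal behavior of $S_\Sigma$, $0\le j\le H$ and $\xi(j)=x$. **Data-driven abstraction.** Let $0\le\ell<H$. Let $\mu_x$ be a probability measure on the states of $S_\Sigma$ (for example one concentrated on $\mathcal X$), $\mu_{\mathbf u_H}$ the uniform distribution on $\mathcal U^H$, $\mu_p=\mu_x\times\mu_{\mathbf u_H}$. Draw $N\ge 0$ i.i.d. samples $(x^i,\mathbf u^i_H)\sim\mu_p$, let $D$ be the set of the $H$-long external behaviors of $S_\Sigma$ that start in $x^i$ under the inputs $\mathbf u^i_H$, $i=1,\dots,N$, and for $m\ge0$ let $\hat\Pi_m=\{\gamma[k-m,k]:\gamma\in D,\ 0\le k\le H\}$. The transition system $\hat S_\ell$ has state set $\hat\Pi_\ell$, initial states those $\zeta\in\hat\Pi_\ell$ of the form $\mathcal H(\xi)[-\ell,0]$ for an internal behavior $\xi$ of $S_\Sigma$, output map $\hat{\mathcal H}(\zeta)=$ last output of $\zeta$, and a transition $\zeta\xrightarrow{u}\zeta'$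 whenever the $(\ell+1)$-sequence obtained by appending $u$ and the last output of $\zeta'$ to $\zeta$ belongs to $\hat\Pi_{\ell+1}$ and has $\zeta'$ as its suffix. Let $\hat{\mathcal R}=\{(x,\zeta):\zeta\in\hat\Pi_\ell\cap\mathcal E_\ell(x)\}$. **Probabilistic simulation.** Let $\mathcal V$ be the set of those initial states $x$ of $S_\Sigma$ for which there exist an input sequence $\mathbf u_H\in\mathcal U^H$ and an $H$-long internal behavior $\xi$ of $S_\Sigma$ from $x$ under $\mathbf u_H$ such that no $H$-long internal behavior $\hat\xi$ of $\hat S_\ell$ under $\mathbf u_H$, starting in an initial state $\zeta_0$ with $(x,\zeta_0)\in\hat{\mathcal R}$, satisfies both $\mathcal H(\xi)=\hat{\mathcal H}(\hat\xi)$ and $(\xi(k),\hat\xi(k))\in\hat{\mathcal R}$ for all $0\le k\le H$. The relation $\hat{\mathcal R}$ is a *probabilistic simulation relation* from $S_\Sigma$ to $\hat S_\ell$ until horizon $H$ with probability not less than $1-\bar\epsilon$ if $\mu_x(\mathcal V)\le\bar\epsilon$. **Scenario bound.** Let $\beta\in(0,1)$. For $0\le k<N$ let $t_k$ be the unique root in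 $(0,1)$ of $$\binom Nk t^{N-k}-\frac{\beta}{N}\sum_{m=k}^{N-1}\binom mk t^{m-k}=0,$$ and put $\epsilon(k,\beta,N)=1-t_k$ for $k<N$, $\epsilon(N,\beta,N)=1$. Let $s^*_{N,\ell}$ be the smallest cardinality of a subset of $D$ that has the same set of $(\ell+1)$-sequences $\hat\Pi_{\ell+1}$ as $D$. **Proposition.** With $\bar\epsilon=\min\bigl(1,\ \epsilon(s^*_{N,\ell},\beta,N)\,|\mathcal U^H|\bigr)$, $$\mu_p^N\Bigl(\hat{\mathcal R}\text{ is a probabilistic simulation relation from }S_\Sigma\text{ to }\hat S_\ell\text{ until horizon }H\text{ with probability not less than }1-\bar\epsilon\Bigr)\ \ge\ 1-\beta .$$ -/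

import Mathlib

open MeasureTheory ProbabilityTheory

/-- A transition system `(𝒳, 𝒳₀, 𝒰, δ, 𝒴, ℋ)` with state set `X`, input set `U`, output set `Y`. -/
structure TransitionSystem (X U Y : Type*) where
  /-- the set `𝒳₀` of initial states -/
  init : Set X
  /-- the transition relation `δ ⊆ 𝒳 × 𝒰 × 𝒳` -/
  trans : X → U → X → Prop
  /-- the output map `ℋ` -/
  out : X → Y

/-- An alternating sequence `m₀ a₀ m₁ … a_{H-1} m_H` with `m_i ∈ M` and `a_i ∈ A`. -/
@[ext]
structure AltSeq (M A : Type*) (H : ℕ) where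
  /-- the entries `m₀, …, m_H` -/
  st : Fin (H + 1) → M
  /-- the entries `a₀, …, a_{H-1}` -/
  act : Fin H → A

/-- An `ℓ`-sequence `y₀ u₀ y₁ … u_{ℓ-1} y_ℓ`, with `ℓ + 1` outputs and `ℓ` inputs, in which an
initial segment of pairs `(y_i, u_i)`, `i < ℓ`, may be replaced by the symbols `⋄ ⋄` that stand for
negative times. `past i` is the pair `(y_i, u_i)`, with `none` for `⋄ ⋄`, and `last` is `y_ℓ`
(which always belongs to a nonnegative time). -/
@[ext]
structure LSeq (Y U : Type*) (ℓ : ℕ) where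
  /-- the pairs `(y_i, u_i)` for `i < ℓ` -/
  past : Fin ℓ → Option (Y × U)
  /-- the last output `y_ℓ` -/
  last : Y

/-- The subsequence `γ[k-ℓ, k]`; entries at negative times are the symbol `⋄`. -/
def AltSeq.window {Y U : Type*} {H : ℕ} (γ : AltSeq Y U H) (ℓ : ℕ) (k : Fin (H + 1)) :
    LSeq Y U ℓ where
  past i :=
    if _h : ℓ ≤ (k : ℕ) + i then
      some (γ.st ⟨(k : ℕ) + i - ℓ, by omega⟩, γ.act ⟨(k : ℕ) + i - ℓ, by omega⟩)
    else none
  last := γ.st k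

/-- The `(ℓ+1)`-sequence `y₀ u₀ … y_ℓ u y'` obtained from `ζ = y₀ u₀ … y_ℓ` by appending `u y'`. -/
def LSeq.append {Y U : Type*} {ℓ : ℕ} (ζ : LSeq Y U ℓ) (u : U) (y' : Y) : LSeq Y U (ℓ + 1) where
  past i := if h : (i : ℕ) < ℓ then ζ.past ⟨i, h⟩ else some (ζ.last, u)
  last := y'

/-- All `ℓ`-sequences `γ[k-ℓ, k]`, `0 ≤ k ≤ H`, of the external behaviors `γ` in `B`. -/
def subseqs {Y U : Type*} {H : ℕ} (B : Set (AltSeq Y U H)) (ℓ : ℕ) : Set (LSeq Y U ℓ) :=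
  {ζ | ∃ γ ∈ B, ∃ k : Fin (H + 1), ζ = γ.window ℓ k}

namespace TransitionSystem

variable {X U Y : Type*}

/-- The external behavior `ℋ(ξ)` of an internal behavior `ξ`. -/
def ext (S : TransitionSystem X U Y) {H : ℕ} (ξ : AltSeq X U H) : AltSeq Y U H where
  st i := S.out (ξ.st i)
  act := ξ.act

/-- The set `𝓘_H(S)` of `H`-long internal behaviors. -/
def internal (S : TransitionSystem X U Y) (H : ℕ) : Set (AltSeq X U H) :=
  {ξ | ξ.st 0 ∈ S.init ∧ ∀ i : Fin H, S.trans (ξ.st i.castSucc) (ξ.act i) (ξ.st i.succ)}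

/-- The set `𝓑_H(S)` of `H`-long external behaviors. -/
def external (S : TransitionSystem X U Y) (H : ℕ) : Set (AltSeq Y U H) :=
  {γ | ∃ ξ ∈ S.internal H, γ = S.ext ξ}

/-- `𝓘_H(S, x₀, u)`: internal behaviors starting in `x₀` under the input sequence `u`. -/
def internalFrom (S : TransitionSystem X U Y) {H : ℕ} (x₀ : X) (u : Fin H → U) :
    Set (AltSeq X U H) :=
  {ξ | ξ ∈ S.internal H ∧ ξ.st 0 = x₀ ∧ ξ.act = u}

/-- `𝓑_H(S, x₀, u)`: external behaviors starting in `x₀` under the input sequence `u`. -/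
def externalFrom (S : TransitionSystem X U Y) {H : ℕ} (x₀ : X) (u : Fin H → U) :
    Set (AltSeq Y U H) :=
  {γ | ∃ ξ ∈ S.internalFrom x₀ u, γ = S.ext ξ}

/-- The corresponding external strings `𝓔_{ℓ,H}(x)`: the `ℓ`-sequences that `S` can generate
up to the moment at which it is in state `x`, within `H` steps. -/
def corrStrings (S : TransitionSystem X U Y) (ℓ H : ℕ) (x : X) : Set (LSeq Y U ℓ) :=
  {ζ | ζ ∈ subseqs (S.external H) ℓ ∧
    ∃ ξ ∈ S.internal H, ∃ j : Fin (H + 1), ζ = (S.ext ξ).window ℓ j ∧ ξ.st j = x}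

/-- The behaviors of `Sb` under the input sequence `u` that start in an initial state of `Sb`
related by `R` to `xa`. -/
def relatedInternal {Xa Xb : Type*} (Sb : TransitionSystem Xb U Y) (R : Set (Xa × Xb)) {H : ℕ}
    (xa : Xa) (u : Fin H → U) : Set (AltSeq Xb U H) :=
  ⋃ xb ∈ {xb | (xa, xb) ∈ R ∧ xb ∈ Sb.init}, Sb.internalFrom xb u

/-- The violation set `𝒱(S_b, R, H)`: the initial states of `Sa` from which some input sequence of
length `H` generates an internal behavior of `Sa` that is not matched, with equal external behavior
and states related by `R` at all times, by a behavior of `Sb` starting in a related initial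
state. -/
def violationSet {Xa Xb : Type*} (Sa : TransitionSystem Xa U Y) (Sb : TransitionSystem Xb U Y)
    (R : Set (Xa × Xb)) (H : ℕ) : Set Xa :=
  {xa | xa ∈ Sa.init ∧ ∃ u : Fin H → U, (Sa.internalFrom xa u).Nonempty ∧
    ∃ ξa ∈ Sa.internalFrom xa u, ¬ ∃ ξb ∈ relatedInternal Sb R xa u,
      Sa.ext ξa = Sb.ext ξb ∧ ∀ k : Fin (H + 1), (ξa.st k, ξb.st k) ∈ R}

/-- `R` is a probabilistic simulation relation from `Sa` to `Sb` until horizon `H` with probability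
not less than `1 - ε`, where initial states of `Sa` are distributed according to `μ`. -/
def IsProbSimRel {Xa Xb : Type*} [MeasurableSpace Xa] (μ : Measure Xa)
    (Sa : TransitionSystem Xa U Y) (Sb : TransitionSystem Xb U Y)
    (R : Set (Xa × Xb)) (H : ℕ) (ε : ℝ) : Prop :=
  μ (violationSet Sa Sb R H) ≤ ENNReal.ofReal ε

/-- The set `D` of sampled external behaviors of `S` for the samples `(xⁱ, uⁱ)`, `i < N`. -/
def sampledBehaviors (S : TransitionSystem X U Y) {H N : ℕ} (ω : Fin N → X × (Fin H → U)) :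
    Set (AltSeq Y U H) :=
  ⋃ i, S.externalFrom (ω i).1 (ω i).2

/-- The data-driven `ℓ`-complete abstraction of `S` built from a set `D` of external behaviors.
States are the `ℓ`-sequences witnessed in `D`, initial are those of the form
`ℋ(ξ)[-ℓ, 0] = ⋄ … ⋄ y`, the output of `ζ` is its last output, and `(ζ, u, ζ')` is a transition if
`ζ[1, ℓ] = ζ'[0, ℓ-1]`, the last input of `ζ'` is `u`, and the domino `ζ · ζ'[ℓ-1, ℓ]` is an
`(ℓ+1)`-sequence witnessed in `D`. -/
def dataAbstraction (S : TransitionSystem X U Y) {H : ℕ} (D : Set (AltSeq Y U H)) (ℓ : ℕ) :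
    TransitionSystem {ζ : LSeq Y U ℓ // ζ ∈ subseqs D ℓ} U Y where
  init := {ζ | ∃ ξ ∈ S.internal H, (S.ext ξ).window ℓ 0 = ζ.1}
  trans ζ u ζ' :=
    -- the first two clauses say `ζ[1, ℓ] = ζ'[0, ℓ-1]` and `ζ'|ᵘ(ℓ-1) = u`
    (∀ i j : Fin ℓ, (i : ℕ) + 1 = j → ζ.1.past j = ζ'.1.past i) ∧
    (∀ i : Fin ℓ, (i : ℕ) + 1 = ℓ → ζ'.1.past i = some (ζ.1.last, u)) ∧
    ζ.1.append u ζ'.1.last ∈ subseqs D (ℓ + 1)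
  out ζ := ζ.1.last

/-- The relation `{(x, ζ) : ζ ∈ 𝓔_ℓ(x)}` between the states of `S` and those of its data-driven
abstraction. -/
def dataRel (S : TransitionSystem X U Y) {H : ℕ} (D : Set (AltSeq Y U H)) (ℓ : ℕ) :
    Set (X × {ζ : LSeq Y U ℓ // ζ ∈ subseqs D ℓ}) :=
  {p | p.2.1 ∈ S.corrStrings ℓ H p.1}

end TransitionSystem

/-- The complexity: the smallest cardinality of a subset of the finite set `D` of sampled behaviors
with the same set of witnessed `(ℓ+1)`-sequences as `D`. -/
noncomputable def complexity {Y U : Type*} {H : ℕ} (D : Set (AltSeq Y U H)) (ℓ : ℕ) : ℕ :=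
  sInf {n | ∃ D' : Finset (AltSeq Y U H), (D' : Set (AltSeq Y U H)) ⊆ D ∧ D'.card = n ∧
    subseqs (D' : Set (AltSeq Y U H)) (ℓ + 1) = subseqs D (ℓ + 1)}

/-- The state set of the transition system of `x⁺ = f(x, u)`, `y = h(x)` on `X`: the set `X`
together with an absorbing state, `Sum.inr ()`. -/
abbrev ConcreteState {E : Type*} (X : Set E) : Type _ := X ⊕ Unit

/-- One step of the system; the absorbing state is entered when `f(x, u)` leaves `X`. -/
noncomputable def concreteStep {E U : Type*} {X : Set E} (f : X → U → E) :
    ConcreteState X → U → ConcreteState X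
  | Sum.inl x, u =>
      open Classical in if hx : f x u ∈ X then Sum.inl ⟨f x u, hx⟩ else Sum.inr ()
  | Sum.inr _, _ => Sum.inr ()

/-- The transition system `S_Σ` of `x⁺ = f(x, u)`, `y = h(x)`. Every state is initial; the
absorbing state carries an output label of its own, `Sum.inr ()`. -/
def concreteSystem {E U Y : Type*} {X : Set E} (f : X → U → E) (h : X → Y) :
    TransitionSystem (ConcreteState X) U (Y ⊕ Unit) where
  init := Set.univ
  trans x u x' := x' = concreteStep f x u
  out := Sum.map h id

/-- The polynomial `C(N,k) t^(N-k) - (β/N) ∑_{m=k}^{N-1} C(m,k) t^(m-k)` of the scenario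
approach. -/
noncomputable def scenarioPoly (β : ℝ) (N k : ℕ) (t : ℝ) : ℝ :=
  (N.choose k : ℝ) * t ^ (N - k) - β / N * ∑ m ∈ Finset.Ico k N, (m.choose k : ℝ) * t ^ (m - k)

/-- For `0 < β < 1` and `k < N`, the polynomial has exactly one root in `(0, 1)`. -/
theorem scenarioPoly_existsUnique_root {β : ℝ} (hβ : β ∈ Set.Ioo (0 : ℝ) 1) {N k : ℕ}
    (hk : k < N) : ∃! t, t ∈ Set.Ioo (0 : ℝ) 1 ∧ scenarioPoly β N k t = 0 := by
  have hN : (0 : ℝ) < N := by exact_mod_cast (by omega : 0 < N)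
  have hC : (0 : ℝ) < N.choose k := by exact_mod_cast Nat.choose_pos hk.le
  have hcont : ContinuousOn (scenarioPoly β N k) (Set.Icc 0 1) := by
    unfold scenarioPoly; fun_prop
  have h0 : scenarioPoly β N k 0 < 0 := by
    have h1 : ∑ m ∈ Finset.Ico k N, (m.choose k : ℝ) * (0 : ℝ) ^ (m - k) = 1 := by
      rw [Finset.sum_eq_single_of_mem k (Finset.mem_Ico.2 ⟨le_rfl, hk⟩)]
      · simp
      · intro m hm hne
        have := (Finset.mem_Ico.1 hm).1
        rw [zero_pow (by omega), mul_zero]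
    rw [scenarioPoly, h1, zero_pow (by omega)]
    have := div_pos hβ.1 hN
    linarith
  have h1 : 0 < scenarioPoly β N k 1 := by
    have hs : ∑ m ∈ Finset.Ico k N, (m.choose k : ℝ) ≤ N * N.choose k := by
      calc _ ≤ ∑ m ∈ Finset.Ico k N, (N.choose k : ℝ) :=
            Finset.sum_le_sum fun m hm => by
              exact_mod_cast Nat.choose_le_choose k (Finset.mem_Ico.1 hm).2.le
        _ = ((N - k : ℕ) : ℝ) * N.choose k := by simp
        _ ≤ _ := by gcongr; omega
    have h2 := mul_le_mul_of_nonneg_left hs (div_pos hβ.1 hN).le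
    have h3 : β / N * (N * N.choose k) = β * N.choose k := by field_simp
    have h4 : β * N.choose k < 1 * N.choose k := mul_lt_mul_of_pos_right hβ.2 hC
    simp only [scenarioPoly, one_pow, mul_one]
    linarith
  obtain ⟨t, ht, hroot⟩ := intermediate_value_Ioo zero_le_one hcont ⟨h0, h1⟩
  have key : ∀ s t : ℝ, 0 < s → s < t → scenarioPoly β N k s = 0 →
      scenarioPoly β N k t = 0 → False := by
    intro s t hs hst hs0 ht0
    unfold scenarioPoly at hs0 ht0
    have hp : N - k = (N - 1 - k) + 1 := by omega
    have hle : s ^ (N - 1 - k) * ∑ m ∈ Finset.Ico k N, (m.choose k : ℝ) * t ^ (m - k) ≤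
        t ^ (N - 1 - k) * ∑ m ∈ Finset.Ico k N, (m.choose k : ℝ) * s ^ (m - k) := by
      rw [Finset.mul_sum, Finset.mul_sum]
      refine Finset.sum_le_sum fun m hm => ?_
      have hm' := Finset.mem_Ico.1 hm
      obtain ⟨d, hd⟩ : ∃ d, N - 1 - k = (m - k) + d := ⟨N - 1 - m, by omega⟩
      rw [hd, pow_add, pow_add]
      have : s ^ d ≤ t ^ d := pow_le_pow_left₀ hs.le hst.le d
      have hnn : 0 ≤ s ^ (m - k) * t ^ (m - k) * (m.choose k : ℝ) := by
        have := hs.trans hst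
        positivity
      nlinarith [mul_le_mul_of_nonneg_left this hnn]
    have hle2 := mul_le_mul_of_nonneg_left hle (div_pos hβ.1 hN).le
    have e1 : β / N * ∑ m ∈ Finset.Ico k N, (m.choose k : ℝ) * t ^ (m - k) =
      N.choose k * t ^ (N - k) := by linarith
    have e2 : β / N * ∑ m ∈ Finset.Ico k N, (m.choose k : ℝ) * s ^ (m - k) =
      N.choose k * s ^ (N - k) := by linarith
    rw [mul_left_comm, e1, mul_left_comm (β / (N : ℝ)), e2, hp, pow_succ, pow_succ] at hle2
    have hpos : 0 < s ^ (N - 1 - k) * t ^ (N - 1 - k) * (N.choose k : ℝ) := by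
      have := hs.trans hst
      positivity
    nlinarith [mul_lt_mul_of_pos_left hst hpos]
  refine ⟨t, ⟨ht, hroot⟩, ?_⟩
  rintro s ⟨hs, hs0⟩
  rcases lt_trichotomy s t with hlt | heq | hgt
  · exact (key s t hs.1 hlt hs0 hroot).elim
  · exact heq
  · exact (key t s ht.1 hgt hroot hs0).elim

/-- The root of `scenarioPoly β N k` in `(0, 1)` (unique for `0 < β < 1` and `k < N`). -/
noncomputable def scenarioRoot (β : ℝ) (N k : ℕ) : ℝ :=
  sSup {t | t ∈ Set.Ioo (0 : ℝ) 1 ∧ scenarioPoly β N k t = 0}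

theorem scenarioRoot_spec {β : ℝ} (hβ : β ∈ Set.Ioo (0 : ℝ) 1) {N k : ℕ} (hk : k < N) :
    scenarioRoot β N k ∈ Set.Ioo (0 : ℝ) 1 ∧ scenarioPoly β N k (scenarioRoot β N k) = 0 := by
  obtain ⟨t, ht, hu⟩ := scenarioPoly_existsUnique_root hβ hk
  have : {t | t ∈ Set.Ioo (0 : ℝ) 1 ∧ scenarioPoly β N k t = 0} = {t} :=
    Set.eq_singleton_iff_unique_mem.2 ⟨ht, fun s hs => hu s hs⟩
  have h2 : scenarioRoot β N k = t := by rw [scenarioRoot, this, csSup_singleton]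
  rw [h2]
  exact ht

/-- The bound `ε(k, β, N)` of the scenario approach on the violation probability of a decision of
complexity `k`: `1 - t` with `t` the root above for `k < N`, and `1` for `k = N`. -/
noncomputable def scenarioEps (k : ℕ) (β : ℝ) (N : ℕ) : ℝ :=
  if k < N then 1 - scenarioRoot β N k else 1

/-! A concrete run all of whose `(ℓ+1)`-sequences occur in `D` is simulated by the sequence of its
own `ℓ`-windows (`exists_relatedInternal_of_subseqs_subset`). Hence a violating state has, for some
input sequence, a behavior showing an `(ℓ+1)`-sequence absent from `D`. The union bound over the
input sequences costs the factor `|U^H|` relative to the probability that a fresh sample shows a new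
`(ℓ+1)`-sequence (`measure_iUnion_section_le`). It remains to bound that probability by
`scenarioEps` of the complexity, outside an event of probability `β`.

Behaviors form a finite type, so this is a statement about i.i.d. draws from a finite law. Compress
`D` to a least subset `c D` with the same `(ℓ+1)`-sequences, so that the size of `c D` is the
complexity. With ties broken by a fixed enumeration, discarding elements of `D` outside `c D` leaves
`c D` unchanged (the preference property).

Let `π_m(C)` be the probability that `m` draws compress to `C`, with `k = |C|`, and let `q` be the
probability that a fresh draw shows nothing new relative to `C`. Removing a redundant draw gives
`(m+1-k) π_{m+1}(C) ≤ (m+1) q π_m(C)`. Iterating and inserting the root equation for `t_k` yields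
`π_N(C) ≤ (β/N) ∑_{m<N} π_m(C)` whenever `1 - q` exceeds `ε(k, β, N)`. Since `∑_C π_m(C) = 1` for
each `m`, summing over all such `C` gives at most `β`. -/

/-! ### The scenario bound for compressions of samples from a finite law. -/

section ScenarioBound

/-- All but `C.card` of the entries of a family that covers `C` can be left out. -/
theorem le_card_filter_subset_image_succAbove {Z : Type*} [DecidableEq Z] {m : ℕ}
    {T : Fin (m + 1) → Z} {C : Finset Z} (hC : C ⊆ Finset.univ.image T) :
    m + 1 - C.card ≤
      (Finset.univ.filter fun j : Fin (m + 1) => C ⊆ Finset.univ.image (j.removeNth T)).card := by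
  have hr : ∀ z : C, ∃ j, T j = z := fun z => by simpa using hC z.2
  choose r hr using hr
  have h1 : (Finset.univ.image r).card ≤ C.card := by
    simpa using Finset.card_image_le (s := Finset.univ) (f := r)
  -- `r` selects one index for each element of `C`; any index not selected is redundant for covering
  -- `C`.
  have h2 : (Finset.univ.image r)ᶜ ⊆
      Finset.univ.filter fun j : Fin (m + 1) => C ⊆ Finset.univ.image (j.removeNth T) := by
    intro j hj
    simp only [Finset.mem_compl, Finset.mem_image, Finset.mem_univ, true_and, not_exists] at hj
    simp only [Finset.mem_filter, Finset.mem_univ, true_and]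
    intro z hz
    obtain ⟨i, hi⟩ := Fin.exists_succAbove_eq (hj ⟨z, hz⟩)
    exact Finset.mem_image.2 ⟨i, Finset.mem_univ _, by rw [Fin.removeNth, hi, hr]⟩
  have h3 := Finset.card_le_card h2
  rw [Finset.card_compl, Fintype.card_fin] at h3
  omega

variable {Z : Type*} [Fintype Z] [DecidableEq Z]

/-- The probability that the compression `c` of `m` independent samples with law `p` is `C`. -/
def selectionProb (p : Z → ℝ) (c : Finset Z → Finset Z) (m : ℕ) (C : Finset Z) : ℝ :=
  ∑ T : Fin m → Z with c (Finset.univ.image T) = C, ∏ i, p (T i)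

theorem selectionProb_nonneg {p : Z → ℝ} (hp : ∀ z, 0 ≤ p z) (c : Finset Z → Finset Z) (m : ℕ)
    (C : Finset Z) : 0 ≤ selectionProb p c m C :=
  Finset.sum_nonneg fun _ _ => Finset.prod_nonneg fun _ _ => hp _

theorem sum_selectionProb {p : Z → ℝ} (hp1 : ∑ z, p z = 1) (c : Finset Z → Finset Z) (m : ℕ) :
    ∑ C, selectionProb p c m C = 1 := by
  unfold selectionProb
  rw [Finset.sum_fiberwise, ← Fintype.piFinset_univ,
    ← Finset.prod_univ_sum (fun _ : Fin m => (Finset.univ : Finset Z)) (fun _ z => p z)]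
  simp [hp1]

/-- Double counting of pairs (sample compressing to `C`, redundant index `j`): each sample has at
least `m + 1 - C.card` such indices. For fixed `j`, the other `m` draws still compress to `C` by
`hpref`, the draw at `j` is `ok` for `C` by `hok`, and these two conditions are independent. -/
theorem selectionProb_succ_le {p : Z → ℝ} (hp : ∀ z, 0 ≤ p z) {c : Finset Z → Finset Z}
    {ok : Finset Z → Z → Prop} [∀ C, DecidablePred (ok C)] (hsub : ∀ D, c D ⊆ D)
    (hpref : ∀ D D', c D ⊆ D' → D' ⊆ D → c D' = c D) (hok : ∀ D, ∀ z ∈ D, ok (c D) z)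
    (m : ℕ) (C : Finset Z) :
    ((m + 1 - C.card : ℕ) : ℝ) * selectionProb p c (m + 1) C ≤
      (m + 1 : ℕ) * ((∑ z with ok C z, p z) * selectionProb p c m C) := by
  have hnn : ∀ {n : ℕ} (T : Fin n → Z), 0 ≤ ∏ i, p (T i) := fun T =>
    Finset.prod_nonneg fun _ _ => hp _
  calc ((m + 1 - C.card : ℕ) : ℝ) * selectionProb p c (m + 1) C
      ≤ ∑ T : Fin (m + 1) → Z with c (Finset.univ.image T) = C,
          ∑ j : Fin (m + 1), if C ⊆ Finset.univ.image (j.removeNth T) then ∏ i, p (T i) else 0 := by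
        rw [selectionProb, Finset.mul_sum]
        refine Finset.sum_le_sum fun T hT => ?_
        have hC : C ⊆ Finset.univ.image T := (Finset.mem_filter.1 hT).2 ▸ hsub _
        rw [← Finset.sum_filter, Finset.sum_const, nsmul_eq_mul]
        exact mul_le_mul_of_nonneg_right
          (by exact_mod_cast le_card_filter_subset_image_succAbove hC) (hnn T)
    _ = ∑ j : Fin (m + 1), ∑ T : Fin (m + 1) → Z, if c (Finset.univ.image T) = C ∧
          C ⊆ Finset.univ.image (j.removeNth T) then ∏ i, p (T i) else 0 := by
        rw [Finset.sum_comm]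
        refine Finset.sum_congr rfl fun j _ => ?_
        rw [Finset.sum_filter]
        exact Finset.sum_congr rfl fun T _ => by rw [ite_and]
    _ ≤ ∑ j : Fin (m + 1), (∑ z with ok C z, p z) * selectionProb p c m C := by
        refine Finset.sum_le_sum fun j _ => ?_
        rw [← (Fin.insertNthEquiv (fun _ => Z) j).sum_comp, Fintype.sum_prod_type,
          selectionProb, Finset.sum_mul_sum, Finset.sum_filter]
        refine Finset.sum_le_sum fun z _ => ?_
        rw [Finset.sum_filter]
        split_ifs with hz
        · refine Finset.sum_le_sum fun T _ => ?_
          have hprod : ∏ i, p ((Fin.insertNthEquiv (fun _ => Z) j) (z, T) i) =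
              p z * ∏ i, p (T i) := by
            rw [Fin.prod_univ_succAbove _ j]
            simp
          rw [hprod]
          split_ifs with h1 h2 h2
          · exact le_rfl
          · refine absurd ?_ h2
            obtain ⟨h3, h4⟩ := h1
            have h5 : j.removeNth ((Fin.insertNthEquiv (fun _ => Z) j) (z, T)) = T :=
              Fin.removeNth_insertNth _ _ _
            rw [h5] at h4
            rw [← h3]
            refine hpref _ _ (h3 ▸ h4) fun x hx => ?_
            obtain ⟨i, -, rfl⟩ := Finset.mem_image.1 hx
            exact Finset.mem_image.2 ⟨j.succAbove i, Finset.mem_univ _, by simp⟩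
          · exact mul_nonneg (hp _) (hnn T)
          · exact le_rfl
        -- A draw that is not `ok` for `C` cannot belong to a sample compressing to `C`, so these
        -- terms vanish.
        · refine (Finset.sum_eq_zero fun T _ => if_neg fun h1 => hz ?_).le
          rw [← h1.1]
          exact hok _ _ (Finset.mem_image.2 ⟨j, Finset.mem_univ _, by simp⟩)
    _ = _ := by simp

/-- The one-step inequality iterated `d` times; the ratios `(j+1)/(j+1-k)` telescope to a quotient
of binomial coefficients. -/
theorem choose_mul_selectionProb_le {p : Z → ℝ} (hp : ∀ z, 0 ≤ p z) {c : Finset Z → Finset Z}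
    {ok : Finset Z → Z → Prop} [∀ C, DecidablePred (ok C)] (hsub : ∀ D, c D ⊆ D)
    (hpref : ∀ D D', c D ⊆ D' → D' ⊆ D → c D' = c D) (hok : ∀ D, ∀ z ∈ D, ok (c D) z)
    {C : Finset Z} {t : ℝ} (ht : ∑ z with ok C z, p z ≤ t) {m : ℕ} (hm : C.card ≤ m) (d : ℕ) :
    (m.choose C.card : ℝ) * selectionProb p c (m + d) C ≤
      ((m + d).choose C.card : ℝ) * (t ^ d * selectionProb p c m C) := by
  have ht0 : 0 ≤ t := (Finset.sum_nonneg fun z _ => hp z).trans ht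
  induction d with
  | zero => simp
  | succ d ih =>
    set k := C.card
    have hpos : (0 : ℝ) < ((m + d + 1 - k : ℕ) : ℝ) := by
      exact_mod_cast (by omega : 0 < m + d + 1 - k)
    have hch : ((m + d + 1 : ℕ) : ℝ) * ((m + d).choose k : ℝ) =
        ((m + d + 1).choose k : ℝ) * ((m + d + 1 - k : ℕ) : ℝ) := by
      have := Nat.choose_mul_succ_eq (m + d) k
      rw [mul_comm]
      exact_mod_cast this
    have hstep := (selectionProb_succ_le hp hsub hpref hok (m + d) C).trans
      (mul_le_mul_of_nonneg_left
        (mul_le_mul_of_nonneg_right ht (selectionProb_nonneg hp c (m + d) C)) (Nat.cast_nonneg _))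
    refine le_of_mul_le_mul_left ?_ hpos
    calc ((m + d + 1 - k : ℕ) : ℝ) * ((m.choose k : ℝ) * selectionProb p c (m + d + 1) C)
        = (m.choose k : ℝ) * (((m + d + 1 - k : ℕ) : ℝ) * selectionProb p c (m + d + 1) C) := by
          ring
      _ ≤ (m.choose k : ℝ) * ((m + d + 1 : ℕ) * (t * selectionProb p c (m + d) C)) :=
          mul_le_mul_of_nonneg_left hstep (Nat.cast_nonneg _)
      _ = (m + d + 1 : ℕ) * t * ((m.choose k : ℝ) * selectionProb p c (m + d) C) := by ring
      _ ≤ (m + d + 1 : ℕ) * t * (((m + d).choose k : ℝ) * (t ^ d * selectionProb p c m C)) :=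
          mul_le_mul_of_nonneg_left ih (by positivity)
      _ = (((m + d + 1 : ℕ) : ℝ) * ((m + d).choose k : ℝ)) *
            (t ^ (d + 1) * selectionProb p c m C) := by ring
      _ = _ := by rw [hch]; simp only [add_assoc]; ring

/-- The reason for the shape of `scenarioPoly`: its root is the value of `t` at which the bounds of
`selectionProb p c N C` by each earlier `selectionProb p c m C`, weighted by `t ^ (m - k)`, add up
to exactly the factor `β / N`. -/
theorem selectionProb_le_of_scenarioEps_lt {β : ℝ} (hβ : β ∈ Set.Ioo (0 : ℝ) 1) {N : ℕ}
    {p : Z → ℝ} (hp : ∀ z, 0 ≤ p z) (hp1 : ∑ z, p z = 1) {c : Finset Z → Finset Z}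
    {ok : Finset Z → Z → Prop} [∀ C, DecidablePred (ok C)] (hsub : ∀ D, c D ⊆ D)
    (hpref : ∀ D D', c D ⊆ D' → D' ⊆ D → c D' = c D) (hok : ∀ D, ∀ z ∈ D, ok (c D) z)
    {C : Finset Z} (hC : scenarioEps C.card β N < ∑ z with ¬ ok C z, p z) :
    selectionProb p c N C ≤ β / N * ∑ m ∈ Finset.range N, selectionProb p c m C := by
  have hsplit := Finset.sum_filter_add_sum_filter_not Finset.univ (ok C) p
  have hle : ∑ z with ¬ ok C z, p z ≤ 1 := by
    have : 0 ≤ ∑ z with ok C z, p z := Finset.sum_nonneg fun z _ => hp z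
    linarith
  by_cases hk : C.card < N
  swap
  -- Here the bound is `1`, which no risk exceeds.
  · rw [scenarioEps, if_neg hk] at hC
    exact absurd hC (not_lt.2 hle)
  rw [scenarioEps, if_pos hk] at hC
  obtain ⟨ht, hroot⟩ := scenarioRoot_spec hβ hk
  set t := scenarioRoot β N C.card
  set k := C.card
  have htok : ∑ z with ok C z, p z ≤ t := by linarith
  have hpos : 0 < (N.choose k : ℝ) * t ^ (N - k) :=
    mul_pos (by exact_mod_cast Nat.choose_pos hk.le) (pow_pos ht.1 _)
  have hβN : 0 ≤ β / N := div_nonneg hβ.1.le (Nat.cast_nonneg _)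
  have hsum : selectionProb p c N C ≤ β / N * ∑ m ∈ Finset.Ico k N, selectionProb p c m C := by
    refine le_of_mul_le_mul_left ?_ hpos
    calc (N.choose k : ℝ) * t ^ (N - k) * selectionProb p c N C
        = β / N * ∑ m ∈ Finset.Ico k N,
            t ^ (m - k) * ((m.choose k : ℝ) * selectionProb p c N C) := by
          rw [scenarioPoly, sub_eq_zero] at hroot
          rw [hroot, mul_assoc, Finset.sum_mul]
          congr 1
          exact Finset.sum_congr rfl fun m _ => by ring
      _ ≤ β / N * ∑ m ∈ Finset.Ico k N,
            (N.choose k : ℝ) * t ^ (N - k) * selectionProb p c m C := by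
          refine mul_le_mul_of_nonneg_left (Finset.sum_le_sum fun m hm => ?_) hβN
          obtain ⟨hkm, hmN⟩ := Finset.mem_Ico.1 hm
          obtain ⟨d, rfl⟩ := Nat.exists_eq_add_of_le hmN.le
          refine (mul_le_mul_of_nonneg_left
            (choose_mul_selectionProb_le hp hsub hpref hok htok hkm d)
            (pow_nonneg ht.1.le _)).trans_eq ?_
          rw [show m + d - k = (m - k) + d by omega, pow_add]
          ring
      _ = _ := by rw [← Finset.mul_sum]; ring
  -- Enlarging the range to all `m < N` removes its dependence on `C.card`, so that the sums over
  -- `C` and `m` can later be exchanged.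
  refine hsum.trans (mul_le_mul_of_nonneg_left (Finset.sum_le_sum_of_subset_of_nonneg ?_
    fun m _ _ => selectionProb_nonneg hp c m C) hβN)
  intro m hm
  exact Finset.mem_range.2 (Finset.mem_Ico.1 hm).2

/-- The scenario bound for a compression `c` with the preference property: outside an event of
probability `β`, the risk of the compressed sample is at most `scenarioEps` of its size. -/
theorem sum_prod_scenarioEps_lt_le {β : ℝ} (hβ : β ∈ Set.Ioo (0 : ℝ) 1) (N : ℕ)
    {p : Z → ℝ} (hp : ∀ z, 0 ≤ p z) (hp1 : ∑ z, p z = 1) {c : Finset Z → Finset Z}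
    {ok : Finset Z → Z → Prop} [∀ C, DecidablePred (ok C)] (hsub : ∀ D, c D ⊆ D)
    (hpref : ∀ D D', c D ⊆ D' → D' ⊆ D → c D' = c D) (hok : ∀ D, ∀ z ∈ D, ok (c D) z)
    (bad : Finset (Finset Z))
    (hbad : ∀ C ∈ bad, scenarioEps C.card β N < ∑ z with ¬ ok C z, p z) :
    ∑ T : Fin N → Z with c (Finset.univ.image T) ∈ bad, ∏ i, p (T i) ≤ β := by
  have hβN : 0 ≤ β / N := div_nonneg hβ.1.le (Nat.cast_nonneg _)
  calc ∑ T : Fin N → Z with c (Finset.univ.image T) ∈ bad, ∏ i, p (T i)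
      = ∑ C ∈ bad, selectionProb p c N C := by
        simp only [selectionProb, Finset.sum_filter]
        rw [Finset.sum_comm]
        exact Finset.sum_congr rfl fun T _ => by rw [Finset.sum_ite_eq]
    _ ≤ ∑ C ∈ bad, β / N * ∑ m ∈ Finset.range N, selectionProb p c m C :=
        Finset.sum_le_sum fun C hC =>
          selectionProb_le_of_scenarioEps_lt hβ hp hp1 hsub hpref hok (hbad C hC)
    _ ≤ ∑ C, β / N * ∑ m ∈ Finset.range N, selectionProb p c m C :=
        Finset.sum_le_sum_of_subset_of_nonneg (Finset.subset_univ _) fun C _ _ =>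
          mul_nonneg hβN (Finset.sum_nonneg fun m _ => selectionProb_nonneg hp c m C)
    _ = β / N * N := by
        rw [← Finset.mul_sum, Finset.sum_comm]
        simp [sum_selectionProb hp1]
    _ ≤ β := by
        -- For `N = 0` the convention `β / 0 = 0` makes the left side zero.
        rcases N.eq_zero_or_pos with rfl | hN
        · simpa using hβ.1.le
        · exact (div_mul_cancel₀ β (by exact_mod_cast hN.ne')).le

end ScenarioBound

/-! ### The minimal cover of a set of behaviors as a compression. -/

section Compression

variable {Y U : Type*} {H : ℕ}

instance AltSeq.finite {M A : Type*} [Finite M] [Finite A] : Finite (AltSeq M A H) :=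
  Finite.of_injective (fun γ : AltSeq M A H => (γ.st, γ.act)) fun _ _ h =>
    AltSeq.ext (Prod.ext_iff.1 h).1 (Prod.ext_iff.1 h).2

theorem subseqs_mono {B B' : Set (AltSeq Y U H)} (h : B ⊆ B') (ℓ : ℕ) :
    subseqs B ℓ ⊆ subseqs B' ℓ := by
  rintro ζ ⟨γ, hγ, k, rfl⟩
  exact ⟨γ, h hγ, k, rfl⟩

/-- `C` is a subset of `D` with the same `m`-sequences that is least for the cardinality, ties being
broken by an enumeration `e`. -/
def IsLeastCover (e : Finset (AltSeq Y U H) → ℕ) (m : ℕ) (D C : Finset (AltSeq Y U H)) : Prop :=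
  (C ⊆ D ∧ subseqs (C : Set (AltSeq Y U H)) m = subseqs (D : Set (AltSeq Y U H)) m) ∧
    ∀ C' ⊆ D, subseqs (C' : Set (AltSeq Y U H)) m = subseqs (D : Set (AltSeq Y U H)) m →
      toLex (C.card, e C) ≤ toLex (C'.card, e C')

theorem exists_isLeastCover (e : Finset (AltSeq Y U H) → ℕ) (m : ℕ) (D : Finset (AltSeq Y U H)) :
    ∃ C, IsLeastCover e m D C := by
  classical
  obtain ⟨C, hC, hmin⟩ := (D.powerset.filter fun C : Finset (AltSeq Y U H) =>
    subseqs (C : Set (AltSeq Y U H)) m = subseqs (D : Set (AltSeq Y U H)) m).exists_min_image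
    (fun C => toLex (C.card, e C)) ⟨D, by simp⟩
  simp only [Finset.mem_filter, Finset.mem_powerset] at hC hmin
  exact ⟨C, hC, fun C' h1 h2 => hmin C' ⟨h1, h2⟩⟩

theorem IsLeastCover.unique {e : Finset (AltSeq Y U H) → ℕ} (he : e.Injective) {m : ℕ}
    {D C C' : Finset (AltSeq Y U H)} (h : IsLeastCover e m D C) (h' : IsLeastCover e m D C') :
    C = C' := by
  have := (h.2 C' h'.1.1 h'.1.2).antisymm (h'.2 C h.1.1 h.1.2)
  exact he (Prod.ext_iff.1 (toLex.injective this)).2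

/-- The preference property, once combined with uniqueness: `D'` lies between `C` and `D`, so all
three have the same `m`-sequences, and `D'` offers fewer competitors than `D`. -/
theorem IsLeastCover.of_subset {e : Finset (AltSeq Y U H) → ℕ} {m : ℕ}
    {D D' C : Finset (AltSeq Y U H)} (h : IsLeastCover e m D C) (hC : C ⊆ D') (hD : D' ⊆ D) :
    IsLeastCover e m D' C := by
  have heq : subseqs (D' : Set (AltSeq Y U H)) m = subseqs (D : Set (AltSeq Y U H)) m :=
    (subseqs_mono (by exact_mod_cast hD) m).antisymm
      (h.1.2 ▸ subseqs_mono (by exact_mod_cast hC) m)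
  exact ⟨⟨hC, h.1.2.trans heq.symm⟩, fun C' h1 h2 => h.2 C' (h1.trans hD) (h2.trans heq)⟩

theorem IsLeastCover.card_eq_complexity {e : Finset (AltSeq Y U H) → ℕ} {ℓ : ℕ}
    {D C : Finset (AltSeq Y U H)} (h : IsLeastCover e (ℓ + 1) D C) :
    C.card = complexity (D : Set (AltSeq Y U H)) ℓ := by
  refine le_antisymm (le_csInf ⟨_, C, by exact_mod_cast h.1.1, rfl, h.1.2⟩ ?_)
    (Nat.sInf_le ⟨C, by exact_mod_cast h.1.1, rfl, h.1.2⟩)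
  rintro _ ⟨C', h1, rfl, h2⟩
  have := h.2 C' (by exact_mod_cast h1) h2
  rw [Prod.Lex.toLex_le_toLex] at this
  rcases this with h3 | h3
  · exact h3.le
  · exact h3.1.le

end Compression

/-! ### Windows of a behavior as a run of the abstraction. -/

section Windows

variable {Y U : Type*} {H : ℕ}

theorem AltSeq.window_mem_subseqs_of_succ {γ : AltSeq Y U H} {ℓ : ℕ} {k : Fin (H + 1)}
    {D : Set (AltSeq Y U H)} (h : γ.window (ℓ + 1) k ∈ subseqs D (ℓ + 1)) :
    γ.window ℓ k ∈ subseqs D ℓ := by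
  obtain ⟨γ', hγ', k', hk⟩ := h
  refine ⟨γ', hγ', k', ?_⟩
  have h1 := congrArg LSeq.past hk
  have h2 := congrArg LSeq.last hk
  have key : ∀ (γ : AltSeq Y U H) (k : Fin (H + 1)) (i : Fin ℓ),
      (γ.window ℓ k).past i = (γ.window (ℓ + 1) k).past i.succ := by
    intro γ k i
    simp only [AltSeq.window, Fin.val_succ]
    by_cases hi : ℓ ≤ (k : ℕ) + i
    · rw [dif_pos hi, dif_pos (by omega)]
      simp only [show (k : ℕ) + (i + 1) - (ℓ + 1) = k + i - ℓ by omega]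
    · rw [dif_neg hi, dif_neg (by omega)]
  refine LSeq.ext (funext fun i => ?_) h2
  rw [key, key, h1]

/-- This identifies the domino demanded by a transition of `dataAbstraction` with an `(ℓ+1)`-window;
the next two lemmas supply the other two clauses of `trans`. -/
theorem AltSeq.append_window (γ : AltSeq Y U H) (ℓ : ℕ) (k : Fin H) :
    (γ.window ℓ k.castSucc).append (γ.act k) (γ.st k.succ) = γ.window (ℓ + 1) k.succ := by
  refine LSeq.ext (funext fun i => ?_) rfl
  simp only [LSeq.append, AltSeq.window, Fin.val_succ, Fin.val_castSucc]
  by_cases hi : (i : ℕ) < ℓ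
  · rw [dif_pos hi]
    by_cases h1 : ℓ ≤ (k : ℕ) + i
    · rw [dif_pos h1, dif_pos (by omega)]
      simp only [show (k : ℕ) + 1 + i - (ℓ + 1) = k + i - ℓ by omega]
    · rw [dif_neg h1, dif_neg (by omega)]
  · have hi' : (i : ℕ) = ℓ := by omega
    rw [dif_neg hi, dif_pos (by omega)]
    have h2 : (k : ℕ) + 1 + i - (ℓ + 1) = k := by omega
    simp only [h2]
    rfl

theorem AltSeq.window_past_succ (γ : AltSeq Y U H) {ℓ : ℕ} (k : Fin H) {i j : Fin ℓ}
    (hij : (i : ℕ) + 1 = j) :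
    (γ.window ℓ k.castSucc).past j = (γ.window ℓ k.succ).past i := by
  simp only [AltSeq.window, Fin.val_succ, Fin.val_castSucc]
  by_cases h1 : ℓ ≤ (k : ℕ) + j
  · rw [dif_pos h1, dif_pos (by omega)]
    simp only [show (k : ℕ) + 1 + i - ℓ = k + j - ℓ by omega]
  · rw [dif_neg h1, dif_neg (by omega)]

theorem AltSeq.window_past_last (γ : AltSeq Y U H) {ℓ : ℕ} (k : Fin H) {i : Fin ℓ}
    (hi : (i : ℕ) + 1 = ℓ) :
    (γ.window ℓ k.succ).past i = some (γ.st k.castSucc, γ.act k) := by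
  simp only [AltSeq.window, Fin.val_succ]
  rw [dif_pos (by omega)]
  have h2 : (k : ℕ) + 1 + i - ℓ = k := by omega
  simp only [h2]
  rfl

namespace TransitionSystem

variable {X : Type*}

/-- An internal behavior all of whose `(ℓ+1)`-sequences are witnessed in `D` is simulated by the
data-driven abstraction. -/
theorem exists_relatedInternal_of_subseqs_subset (S : TransitionSystem X U Y)
    {D : Set (AltSeq Y U H)} {ℓ : ℕ} {x : X} {u : Fin H → U} {ξ : AltSeq X U H}
    (hξ : ξ ∈ S.internalFrom x u)
    (hD : subseqs {S.ext ξ} (ℓ + 1) ⊆ subseqs D (ℓ + 1)) :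
    ∃ ξb ∈ relatedInternal (S.dataAbstraction D ℓ) (S.dataRel D ℓ) x u,
      S.ext ξ = (S.dataAbstraction D ℓ).ext ξb ∧
        ∀ k : Fin (H + 1), (ξ.st k, ξb.st k) ∈ S.dataRel D ℓ := by
  obtain ⟨hint, hx, hu⟩ := hξ
  have hw : ∀ k, (S.ext ξ).window (ℓ + 1) k ∈ subseqs D (ℓ + 1) := fun k =>
    hD ⟨_, rfl, k, rfl⟩
  have hrel : ∀ k, (S.ext ξ).window ℓ k ∈ S.corrStrings ℓ H (ξ.st k) := fun k =>
    ⟨⟨_, ⟨ξ, hint, rfl⟩, k, rfl⟩, ξ, hint, k, rfl, rfl⟩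
  -- The simulating run remembers the last `ℓ` steps of `ξ`. Each of its states lies in `𝓔_ℓ` of the
  -- matching concrete state because `ξ` itself is the witness.
  let ξb : AltSeq {ζ : LSeq Y U ℓ // ζ ∈ subseqs D ℓ} U H :=
    ⟨fun k => ⟨(S.ext ξ).window ℓ k, AltSeq.window_mem_subseqs_of_succ (hw k)⟩, ξ.act⟩
  have hinit : ξb.st 0 ∈ (S.dataAbstraction D ℓ).init := ⟨ξ, hint, rfl⟩
  refine ⟨ξb, Set.mem_biUnion (x := ξb.st 0) ⟨hx ▸ hrel 0, hinit⟩ ⟨⟨hinit, fun i => ?_⟩, rfl, hu⟩,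
    rfl, hrel⟩
  refine ⟨fun a b hab => AltSeq.window_past_succ _ i hab,
    fun a ha => AltSeq.window_past_last _ i ha, ?_⟩
  have := hw i.succ
  rw [← AltSeq.append_window] at this
  exact this

theorem violationSet_subset (S : TransitionSystem X U Y) (D : Set (AltSeq Y U H)) (ℓ : ℕ) :
    violationSet S (S.dataAbstraction D ℓ) (S.dataRel D ℓ) H ⊆
      ⋃ u : Fin H → U, {x | ∃ γ ∈ S.externalFrom x u,
        ¬ subseqs {γ} (ℓ + 1) ⊆ subseqs D (ℓ + 1)} := by
  rintro x ⟨-, u, -, ξ, hξ, hno⟩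
  exact Set.mem_iUnion.2 ⟨u, S.ext ξ, ⟨ξ, hξ, rfl⟩, fun hD =>
    hno (S.exists_relatedInternal_of_subseqs_subset hξ hD)⟩

end TransitionSystem

end Windows

/-! ### Uniqueness and measurability of the concrete behavior. -/

section Deterministic

variable {E U Y : Type*} {X : Set E} {H : ℕ}

/-- The state after `k` steps (`H` steps if `k > H`) from `x` under the inputs `u`. -/
noncomputable def concreteRun (f : X → U → E) (u : Fin H → U) (x : ConcreteState X) :
    ℕ → ConcreteState X
  | 0 => x
  | k + 1 => if hk : k < H then concreteStep f (concreteRun f u x k) (u ⟨k, hk⟩)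
      else concreteRun f u x k

/-- The external behavior of the concrete system from `p.1` under the inputs `p.2`. -/
noncomputable def concreteBehavior (f : X → U → E) (h : X → Y)
    (p : ConcreteState X × (Fin H → U)) : AltSeq (Y ⊕ Unit) U H where
  st i := Sum.map h id (concreteRun f p.2 p.1 i)
  act := p.2

theorem externalFrom_concreteSystem (f : X → U → E) (h : X → Y) (x : ConcreteState X)
    (u : Fin H → U) :
    (concreteSystem f h).externalFrom x u = {concreteBehavior f h (x, u)} := by
  refine Set.eq_singleton_iff_unique_mem.2 ⟨⟨⟨fun i => concreteRun f u x i, u⟩,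
    ⟨⟨trivial, fun i => ?_⟩, rfl, rfl⟩, rfl⟩, ?_⟩
  · simp [concreteSystem, concreteRun]
  · rintro _ ⟨ξ, ⟨⟨-, htr⟩, rfl, rfl⟩, rfl⟩
    have key : ∀ i : Fin (H + 1), ξ.st i = concreteRun f ξ.act (ξ.st 0) i := by
      intro i
      induction i using Fin.induction with
      | zero => rfl
      | succ i ih =>
        have := htr i
        simp only [concreteSystem] at this
        rw [this, ih]
        simp [concreteRun]
    refine AltSeq.ext (funext fun i => ?_) rfl
    change Sum.map h id (ξ.st i) = Sum.map h id _
    rw [key]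

theorem measurable_concreteStep [MeasurableSpace E] (hX : MeasurableSet X) {f : X → U → E} {u : U}
    (hf : Measurable fun x => f x u) : Measurable fun x => concreteStep f x u := by
  classical
  refine measurable_fun_sum ?_ measurable_const
  have hs : MeasurableSet {x : X | f x u ∈ X} := hf hX
  have : ((fun x => concreteStep f x u) ∘ Sum.inl) = fun x : X =>
      if hx : x ∈ {x : X | f x u ∈ X} then (Sum.inl ⟨f x u, hx⟩ : ConcreteState X)
      else Sum.inr () := by
    funext x
    simp only [Function.comp, concreteStep, Set.mem_ofPred_eq]
  rw [this]
  exact Measurable.dite (s := {x : X | f x u ∈ X})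
    (f := fun x => (Sum.inl ⟨f x u, x.2⟩ : ConcreteState X)) (g := fun _ => Sum.inr ())
    (measurable_inl.comp ((hf.comp measurable_subtype_coe).subtype_mk)) measurable_const hs

theorem measurable_concreteRun [MeasurableSpace E] (hX : MeasurableSet X) {f : X → U → E}
    (hf : ∀ u, Measurable fun x => f x u) (u : Fin H → U) (k : ℕ) :
    Measurable fun x => concreteRun f u x k := by
  induction k with
  | zero => exact measurable_id
  | succ k ih =>
    by_cases hk : k < H
    · simp only [concreteRun, dif_pos hk]
      exact (measurable_concreteStep hX (hf _)).comp ih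
    · simpa only [concreteRun, dif_neg hk] using ih

theorem measurableSet_concreteBehavior_fiber [MeasurableSpace E] [Countable U] [MeasurableSpace U]
    [MeasurableSingletonClass U] [MeasurableSpace Y] [MeasurableSingletonClass Y]
    (hX : MeasurableSet X) {f : X → U → E} (hf : ∀ u, Measurable fun x => f x u) {h : X → Y}
    (hh : Measurable h) (γ : AltSeq (Y ⊕ Unit) U H) :
    MeasurableSet (concreteBehavior f h ⁻¹' {γ}) := by
  -- Only the inputs `γ.act` can produce `γ`, so the fiber is a rectangle: finitely many output
  -- conditions on the initial state, times a single input sequence.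
  have : concreteBehavior f h ⁻¹' {γ} =
      (⋂ i : Fin (H + 1), (fun x => Sum.map h id (concreteRun f γ.act x i)) ⁻¹' {γ.st i}) ×ˢ
        {γ.act} := by
    ext ⟨x, u⟩
    simp only [Set.mem_preimage, Set.mem_singleton_iff, AltSeq.ext_iff, concreteBehavior,
      funext_iff, Set.mem_prod, Set.mem_iInter]
    constructor
    · rintro ⟨h1, h2⟩
      obtain rfl : u = γ.act := funext h2
      exact ⟨h1, fun _ => rfl⟩
    · rintro ⟨h1, h2⟩
      obtain rfl : u = γ.act := funext h2
      exact ⟨h1, fun _ => rfl⟩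
  rw [this]
  refine (MeasurableSet.iInter fun i => ?_).prod (measurableSet_singleton _)
  refine ((hh.sumMap measurable_id).comp (measurable_concreteRun hX hf γ.act i)) ?_
  rcases γ.st i with y | y
  · rw [← Set.image_singleton]; exact (measurableSet_singleton y).inl_image
  · rw [← Set.image_singleton]; exact (measurableSet_singleton y).inr_image

end Deterministic

/-! ### Transfer from the finite law of behaviors to the sampling measure. -/

theorem MeasureTheory.measure_iUnion_section_le {A B : Type*} [MeasurableSpace A]
    [MeasurableSpace B] [Fintype B] [Nonempty B] [MeasurableSingletonClass B] (μ : Measure A)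
    [SFinite μ] {s : Set (A × B)} (hs : MeasurableSet s) :
    μ (⋃ b, {a | (a, b) ∈ s}) ≤
      (μ.prod (uniformOn (Set.univ : Set B))) s * (Fintype.card B : ENNReal) := by
  have hcard : (Fintype.card B : ENNReal) ≠ 0 := by simp
  calc μ (⋃ b, {a | (a, b) ∈ s}) ≤ ∑ b, μ {a | (a, b) ∈ s} := measure_iUnion_fintype_le _ _
    _ = _ := by
        -- The product measure averages the section measures with weight `1 / card B`; multiplying
        -- by `card B` recovers their sum.
        rw [Measure.prod_apply_symm hs, lintegral_fintype, Finset.sum_mul]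
        refine Finset.sum_congr rfl fun b _ => ?_
        rw [uniformOn_univ, Measure.count_singleton, mul_assoc,
          ENNReal.div_mul_cancel hcard (ENNReal.natCast_ne_top _), mul_one]
        rfl

open Classical in
/-- The scenario bound for the complexity of a finite family of behaviors: outside an event of
probability `β`, a further behavior shows a new `(ℓ+1)`-sequence with probability at most
`scenarioEps` of the complexity. -/
theorem sum_prod_scenarioEps_complexity_lt_le {Y U : Type*} {H : ℕ} [Fintype (AltSeq Y U H)]
    {β : ℝ} (hβ : β ∈ Set.Ioo (0 : ℝ) 1) (N ℓ : ℕ) {p : AltSeq Y U H → ℝ} (hp : ∀ γ, 0 ≤ p γ)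
    (hp1 : ∑ γ, p γ = 1) :
    ∑ T : Fin N → AltSeq Y U H with scenarioEps (complexity (Set.range T) ℓ) β N <
      ∑ γ with ¬ subseqs {γ} (ℓ + 1) ⊆ subseqs (Set.range T) (ℓ + 1), p γ, ∏ i, p (T i) ≤ β := by
  -- Injectivity of `e` makes the least cover unique, hence the chosen `c` satisfies the preference
  -- property.
  obtain ⟨e, he⟩ : ∃ e : Finset (AltSeq Y U H) → ℕ, e.Injective :=
    ⟨fun C => Fintype.equivFin _ C, Fin.val_injective.comp (Equiv.injective _)⟩
  choose c hc using fun D : Finset (AltSeq Y U H) => exists_isLeastCover e (ℓ + 1) D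
  refine le_of_eq_of_le ?_ (sum_prod_scenarioEps_lt_le (c := c)
    (ok := fun C γ => subseqs {γ} (ℓ + 1) ⊆ subseqs (C : Set (AltSeq Y U H)) (ℓ + 1)) hβ N hp hp1
    (fun D => (hc D).1.1) (fun D D' h1 h2 => (hc D').unique he ((hc D).of_subset h1 h2))
    (fun D γ hγ => ?_) (Finset.univ.filter fun C => scenarioEps C.card β N <
      ∑ γ with ¬ subseqs {γ} (ℓ + 1) ⊆ subseqs (C : Set (AltSeq Y U H)) (ℓ + 1), p γ)
    fun C hC => (Finset.mem_filter.1 hC).2)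
  · refine Finset.sum_congr (Finset.filter_congr fun T _ => ?_) fun _ _ => rfl
    have hT : ((Finset.univ.image T : Finset (AltSeq Y U H)) : Set (AltSeq Y U H)) =
        Set.range T := by
      simp
    rw [Finset.mem_filter, (hc _).card_eq_complexity, (hc _).1.2, hT]
    simp
  · rw [(hc D).1.2]
    exact subseqs_mono (by simpa using hγ) _

theorem mainTheorem2 {n : ℕ} (X : Set (EuclideanSpace ℝ (Fin n))) (hX : MeasurableSet X)
    {U Y : Type*} [Fintype U] [Nonempty U] [MeasurableSpace U] [MeasurableSingletonClass U]
    [Finite Y] [MeasurableSpace Y] [MeasurableSingletonClass Y]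
    (f : X → U → EuclideanSpace ℝ (Fin n)) (hf : ∀ u, Measurable fun x => f x u)
    (h : X → Y) (hh : Measurable h)
    (ℓ H : ℕ) (hℓ : ℓ < H) (N : ℕ) (β : ℝ) (hβ : β ∈ Set.Ioo (0 : ℝ) 1)
    (μx : Measure (ConcreteState X)) [IsProbabilityMeasure μx] :
    ENNReal.ofReal (1 - β) ≤
      (Measure.pi fun _ : Fin N => μx.prod (uniformOn (Set.univ : Set (Fin H → U))))
        {ω | (concreteSystem f h).IsProbSimRel μx
          ((concreteSystem f h).dataAbstraction ((concreteSystem f h).sampledBehaviors ω) ℓ)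
          ((concreteSystem f h).dataRel ((concreteSystem f h).sampledBehaviors ω) ℓ) H
          (min 1 (scenarioEps (complexity ((concreteSystem f h).sampledBehaviors ω) ℓ) β N *
            (Fintype.card (Fin H → U) : ℝ)))} := by
  classical
  have : Fintype (AltSeq (Y ⊕ Unit) U H) := Fintype.ofFinite _
  set P := μx.prod (uniformOn (Set.univ : Set (Fin H → U))) with hP
  let φ : ConcreteState X × (Fin H → U) → AltSeq (Y ⊕ Unit) U H := concreteBehavior f h
  have hφ : ∀ γ, MeasurableSet (φ ⁻¹' {γ}) := measurableSet_concreteBehavior_fiber hX hf hh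
  have hφs : ∀ s : Finset (AltSeq (Y ⊕ Unit) U H),
      P.real (φ ⁻¹' (s : Set (AltSeq (Y ⊕ Unit) U H))) = ∑ γ ∈ s, P.real (φ ⁻¹' {γ}) := fun s => by
    rw [measureReal_def, ← sum_measure_preimage_singleton s fun γ _ => hφ γ,
      ENNReal.toReal_sum fun _ _ => measure_ne_top _ _]
    rfl
  -- The law of the behavior of one random sample.
  let p : AltSeq (Y ⊕ Unit) U H → ℝ := fun γ => P.real (φ ⁻¹' {γ})
  let F := Finset.univ.filter fun T : Fin N → AltSeq (Y ⊕ Unit) U H =>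
    scenarioEps (complexity (Set.range T) ℓ) β N <
      ∑ γ with ¬ subseqs {γ} (ℓ + 1) ⊆ subseqs (Set.range T) (ℓ + 1), p γ
  have hbound : ∑ T ∈ F, ∏ i, p (T i) ≤ β :=
    sum_prod_scenarioEps_complexity_lt_le hβ N ℓ (fun γ => measureReal_nonneg)
      (by rw [← hφs]; simp)
  have hDω : ∀ ω : Fin N → ConcreteState X × (Fin H → U),
      (concreteSystem f h).sampledBehaviors ω =
        Set.range fun i => φ (ω i) := by
    intro ω
    ext γ
    simp [TransitionSystem.sampledBehaviors, externalFrom_concreteSystem, φ, eq_comm]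
  set Q := Measure.pi fun _ : Fin N => P
  set G := {ω : Fin N → ConcreteState X × (Fin H → U) | (concreteSystem f h).IsProbSimRel μx
          ((concreteSystem f h).dataAbstraction ((concreteSystem f h).sampledBehaviors ω) ℓ)
          ((concreteSystem f h).dataRel ((concreteSystem f h).sampledBehaviors ω) ℓ) H
          (min 1 (scenarioEps (complexity ((concreteSystem f h).sampledBehaviors ω) ℓ) β N *
            (Fintype.card (Fin H → U) : ℝ)))} with hG
  have hgood : ∀ ω, (fun i => φ (ω i)) ∉ F → ω ∈ G := by
    intro ω hω
    -- Outside `F`, the chance of a new `(ℓ+1)`-sequence is at most the scenario bound.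
    have hv : ∑ γ with ¬ subseqs {γ} (ℓ + 1) ⊆ subseqs (Set.range fun i => φ (ω i)) (ℓ + 1), p γ ≤
        scenarioEps (complexity (Set.range fun i => φ (ω i)) ℓ) β N := by
      simpa only [F, Finset.mem_filter, Finset.mem_univ, true_and, not_lt] using hω
    change μx _ ≤ _
    rw [hDω ω, ENNReal.ofReal_min, ENNReal.ofReal_one]
    refine le_min prob_le_one ((measure_mono (TransitionSystem.violationSet_subset _ _ ℓ)).trans ?_)
    let s : Finset (AltSeq (Y ⊕ Unit) U H) := Finset.univ.filter fun γ =>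
      ¬ subseqs {γ} (ℓ + 1) ⊆ subseqs (Set.range fun i => φ (ω i)) (ℓ + 1)
    have hs : MeasurableSet (φ ⁻¹' (s : Set (AltSeq (Y ⊕ Unit) U H))) := by
      rw [← Finset.set_biUnion_preimage_singleton]
      exact s.measurableSet_biUnion fun γ _ => hφ γ
    refine (measure_mono ?_).trans ((measure_iUnion_section_le μx hs).trans ?_)
    · refine Set.iUnion_mono fun u x hx => ?_
      obtain ⟨γ, hγ, hne⟩ := hx
      rw [externalFrom_concreteSystem] at hγ
      obtain rfl : γ = φ (x, u) := hγ
      change φ (x, u) ∈ (s : Set _)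
      exact Finset.mem_coe.2 (Finset.mem_filter.2 ⟨Finset.mem_univ _, hne⟩)
    · rw [← hP, ENNReal.ofReal_mul' (Nat.cast_nonneg _), ENNReal.ofReal_natCast]
      refine mul_le_mul_left ?_ _
      rw [← ofReal_measureReal, hφs]
      exact ENNReal.ofReal_le_ofReal hv
  have hbad : Q Gᶜ ≤ ENNReal.ofReal β := by
    -- The bad event is covered by finitely many boxes, one for each bad tuple of behaviors, and the
    -- measure of a box is the product of the fiber probabilities.
    calc Q Gᶜ ≤ Q (⋃ T ∈ F, Set.univ.pi fun i => φ ⁻¹' {T i}) := by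
          refine measure_mono fun ω hω => ?_
          have h1 : (fun i => φ (ω i)) ∈ F := by
            by_contra h2
            exact hω (hgood ω h2)
          exact Set.mem_biUnion (x := fun i => φ (ω i))
            (Finset.mem_coe.2 h1) fun i _ => rfl
      _ ≤ ∑ T ∈ F, Q (Set.univ.pi fun i => φ ⁻¹' {T i}) := measure_biUnion_finset_le _ _
      _ = ENNReal.ofReal (∑ T ∈ F, ∏ i, p (T i)) := by
          rw [ENNReal.ofReal_sum_of_nonneg fun T _ =>
            Finset.prod_nonneg fun _ _ => measureReal_nonneg]
          refine Finset.sum_congr rfl fun T _ => ?_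
          rw [Measure.pi_pi, ENNReal.ofReal_prod_of_nonneg fun _ _ => measureReal_nonneg]
          exact Finset.prod_congr rfl fun i _ => (ofReal_measureReal (measure_ne_top _ _)).symm
      _ ≤ _ := ENNReal.ofReal_le_ofReal hbound
  -- Subadditivity is enough here, so measurability of `G` is not needed.
  have htot : 1 ≤ Q G + Q Gᶜ := by
    rw [← measure_univ (μ := Q), ← Set.union_compl_self G]
    exact measure_union_le _ _
  rw [ENNReal.ofReal_sub _ hβ.1.le, ENNReal.ofReal_one]
  exact tsub_le_iff_right.2 (htot.trans (add_le_add le_rfl hbad))
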